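/- For $N=2^k$ ($k\ge 0$) let $\star_k$ be the Laver table operation of order $2^k$, that is, the unique binary operation $\star$ on $\{1,\dots,N\}$ such that for all $p,q$ one has $p\star 1\equiv p+1 \pmod N$ and $p\star(q\star 1)=(p\star q)\star(p\star 1)$. For integers $p,q\ge 0$ put $$p*q:=N-\big((N-p)\star_k(N-q)\big),\qquad N=2^k>\max(p,q);$$ this value does not depend on the choice of $k$. For $p\ge 1$ let $\pi(p)$ be the period of the row of $p$, i.e. the least integer $t\ge 1$ such that $p*(q+t)=p*q$ for all $q\ge 0$. Let $n\ge 0$ and $0\le r<2^{2^n}$ be integers. Then for every integer $q\ge 0$ $$2^{2^n}\big((1+r)*q\big)=\big(1+r\,2^{2^n}\big)*q .$$ Consequently the periods $\pi(1+r)$ and $\pi(1+r\,2^{2^n})$ exist and are equal: when $\pi(1),\dots,\pi(2^{2^{n+1}})$ are arranged in increasing order of the argument in a $2^{2^n}\times 2^{2^n}$ table, the first row and the first column of the table coincide. -/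

import Mathlib

/-- The operation `⋆` on `{1, …, N}` determined by `p ⋆ 1 = p + 1 mod N` (representatives in
`{1, …, N}`) and `p ⋆ (q + 1) = (p ⋆ q) ⋆ (p + 1)`, computed by descending recursion on `p` and
ascending recursion on `q`; the row of `N` is `N ⋆ q = q`.  The test `p < a` always succeeds on
`{1, …, N}` (`laverStar_gt`); arguments outside `{1, …, N}` carry no meaning. -/
def laverStar (N p : ℕ) : ℕ → ℕ
  | 0 => 0
  | 1 => p % N + 1
  | q + 2 =>
    if N ≤ p then q + 2
    else
      let a := laverStar N p (q + 1)
      if p < a then laverStar N a (p + 1) else 0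
termination_by q => (N - p, q)
decreasing_by
  · exact Prod.Lex.right _ (by omega)
  · exact Prod.Lex.left _ _ (by omega)

theorem laverStar_one (N p : ℕ) : laverStar N p 1 = p % N + 1 := by
  rw [laverStar]

theorem laverStar_self (N : ℕ) {q : ℕ} (hq : 1 ≤ q) : laverStar N N q = q := by
  match q, hq with
  | 1, _ => simp [laverStar_one]
  | q + 2, _ => rw [laverStar]; simp

/-- `p < p ⋆ q ≤ N` for `p < N`. -/
theorem laverStar_gt (N : ℕ) : ∀ (k p q : ℕ), N - p ≤ k → p < N → 1 ≤ q →
    p < laverStar N p q ∧ laverStar N p q ≤ N := by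
  intro k
  induction k with
  | zero => intro p q h1 h2; omega
  | succ k ih =>
    intro p q h1 h2 hq
    induction q, hq using Nat.le_induction with
    | base => rw [laverStar_one, Nat.mod_eq_of_lt h2]; omega
    | succ q hq ihq =>
      obtain ⟨q, rfl⟩ : ∃ q', q = q' + 1 := ⟨q - 1, by omega⟩
      rw [laverStar, if_neg (by omega)]
      simp only [if_pos ihq.1]
      rcases ihq.2.lt_or_eq with h | h
      · have := ih (laverStar N p (q + 1)) (p + 1) (by omega) h (by omega)
        omega
      · rw [h, laverStar_self N (by omega)]; omega

theorem laverStar_succ {N p q : ℕ} (hp : p < N) (hq : 1 ≤ q) :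
    laverStar N p (q + 1) = laverStar N (laverStar N p q) (p + 1) := by
  obtain ⟨q, rfl⟩ : ∃ q', q = q' + 1 := ⟨q - 1, by omega⟩
  have h := (laverStar_gt N _ p (q + 1) le_rfl hp (by omega)).1
  conv_lhs => rw [laverStar, if_neg (by omega)]
  simp only [if_pos h]

/-- `{1, …, N}` is closed under `⋆`. -/
theorem laverStar_mem {N p q : ℕ} (hp : p ∈ Set.Icc 1 N) (hq : q ∈ Set.Icc 1 N) :
    laverStar N p q ∈ Set.Icc 1 N := by
  rcases hp.2.lt_or_eq with h | h
  · have := laverStar_gt N _ p q le_rfl h hq.1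
    exact ⟨by omega, this.2⟩
  · rw [h, laverStar_self N hq.1]; exact hq

/-- The law `p ⋆ (q ⋆ 1) = (p ⋆ q) ⋆ (p ⋆ 1)`, here for `q < N`. -/
theorem laverStar_law {N p q : ℕ} (hp : p ∈ Set.Icc 1 N) (hq : 1 ≤ q) (hqN : q < N) :
    laverStar N p (laverStar N q 1)
      = laverStar N (laverStar N p q) (laverStar N p 1) := by
  rw [laverStar_one N q, Nat.mod_eq_of_lt hqN]
  rcases hp.2.lt_or_eq with h | h
  · rw [laverStar_succ h hq, laverStar_one N p, Nat.mod_eq_of_lt h]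
  · subst h
    rw [laverStar_self p (by omega), laverStar_self p hq, laverStar_self p le_rfl, laverStar_one,
      Nat.mod_eq_of_lt hqN]

/-- Uniqueness: the two defining laws determine `⋆` on `{1, …, N}`. -/
theorem laverStar_unique {N : ℕ} (op : ℕ → ℕ → ℕ)
    (hmem : ∀ p ∈ Set.Icc 1 N, ∀ q ∈ Set.Icc 1 N, op p q ∈ Set.Icc 1 N)
    (h1 : ∀ p ∈ Set.Icc 1 N, op p 1 = p % N + 1)
    (h2 : ∀ p ∈ Set.Icc 1 N, ∀ q ∈ Set.Icc 1 N, q < N →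
      op p (op q 1) = op (op p q) (op p 1)) :
    ∀ p ∈ Set.Icc 1 N, ∀ q ∈ Set.Icc 1 N, op p q = laverStar N p q := by
  have hs : ∀ p ∈ Set.Icc 1 N, ∀ q, 1 ≤ q → q < N → op p (q + 1) = op (op p q) (p % N + 1) := by
    intro p hp q hq hqN
    have := h2 p hp q ⟨hq, hqN.le⟩ hqN
    rwa [h1 q ⟨hq, hqN.le⟩, Nat.mod_eq_of_lt hqN, h1 p hp] at this
  have hN : ∀ q, 1 ≤ q → q ≤ N → op N q = q := by
    intro q hq
    induction q, hq using Nat.le_induction with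
    | base => intro h; rw [h1 N ⟨h, le_rfl⟩]; simp
    | succ q hq ih =>
      intro h
      rw [hs N ⟨by omega, le_rfl⟩ q hq (by omega), ih (by omega), Nat.mod_self, zero_add,
        h1 q ⟨hq, by omega⟩, Nat.mod_eq_of_lt (by omega)]
  have key : ∀ k p, N - p ≤ k → p ∈ Set.Icc 1 N → ∀ q, 1 ≤ q → q ≤ N →
      op p q = laverStar N p q := by
    intro k
    induction k with
    | zero =>
      intro p hk hp q hq hqN
      obtain rfl : p = N := by have := hp.2; omega
      rw [hN q hq hqN, laverStar_self p hq]
    | succ k ih =>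
      intro p hk hp q hq
      rcases hp.2.lt_or_eq with h | h
      · induction q, hq using Nat.le_induction with
        | base => intro _; rw [h1 p hp, laverStar_one]
        | succ q hq ihq =>
          intro hqN
          have hg := laverStar_gt N _ p q le_rfl h hq
          rw [hs p hp q hq (by omega), ihq (by omega), laverStar_succ h hq, Nat.mod_eq_of_lt h]
          exact ih _ (by omega) ⟨by omega, hg.2⟩ _ (by omega) (by omega)
      · intro hqN
        subst h
        rw [hN q hq hqN, laverStar_self p hq]
  exact fun p hp q hq => key _ p le_rfl hp q hq.1 hq.2

/-- The residue in `{1, …, N}` of `x ∈ {1, …, 2N}`. -/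
def foldRep (N x : ℕ) : ℕ := if x ≤ N then x else x - N

theorem laverStar_foldRep {N : ℕ} (hN : 1 ≤ N)
    (hT : ∀ p, 1 ≤ p → p ≤ N → laverStar N p N = N) :
    ∀ k p, 2 * N - p ≤ k → 1 ≤ p → p ≤ 2 * N → ∀ q, 1 ≤ q → q ≤ 2 * N →
      foldRep N (laverStar (2 * N) p q) = laverStar N (foldRep N p) (foldRep N q) := by
  have hbase : ∀ q, 1 ≤ q → foldRep N (laverStar (2 * N) (2 * N) q)
      = laverStar N (foldRep N (2 * N)) (foldRep N q) := by
    intro q hq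
    have h1 : foldRep N (2 * N) = N := by unfold foldRep; split_ifs <;> omega
    have h2 : 1 ≤ foldRep N q := by unfold foldRep; split_ifs <;> omega
    rw [laverStar_self _ hq, h1, laverStar_self _ h2]
  intro k
  induction k with
  | zero =>
    intro p hk hp hpN q hq hqN
    obtain rfl : p = 2 * N := by omega
    exact hbase q hq
  | succ k ih =>
    intro p hk hp hpN q hq
    rcases hpN.lt_or_eq with h | h
    swap
    · subst h; exact fun _ => hbase q hq
    have hP : 1 ≤ foldRep N p ∧ foldRep N p ≤ N := by unfold foldRep; split_ifs <;> omega
    induction q, hq using Nat.le_induction with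
    | base =>
      intro _
      have h1 : foldRep N 1 = 1 := by unfold foldRep; split_ifs <;> omega
      rw [laverStar_one, Nat.mod_eq_of_lt h, h1, laverStar_one]
      rcases hP.2.lt_or_eq with h2 | h2
      · rw [Nat.mod_eq_of_lt h2]
        unfold foldRep at h2 ⊢
        split_ifs at h2 ⊢ <;> omega
      · rw [h2, Nat.mod_self]
        unfold foldRep at h2 ⊢
        split_ifs at h2 ⊢ <;> omega
    | succ q hq ihq =>
      intro hqN
      have hg := laverStar_gt (2 * N) _ p q le_rfl h hq
      have hQ : 1 ≤ foldRep N q ∧ foldRep N q ≤ N := by unfold foldRep; split_ifs <;> omega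
      rw [laverStar_succ h hq,
        ih _ (by omega) (by omega) hg.2 (p + 1) (by omega) (by omega), ihq (by omega)]
      rcases hP.2.lt_or_eq with h2 | h2
      · have h3 : foldRep N (p + 1) = foldRep N p + 1 := by
          unfold foldRep at h2 ⊢; split_ifs at h2 ⊢ <;> omega
        rw [h3]
        rcases hQ.2.lt_or_eq with h4 | h4
        · have h5 : foldRep N (q + 1) = foldRep N q + 1 := by
            unfold foldRep at h4 ⊢; split_ifs at h4 ⊢ <;> omega
          rw [h5, laverStar_succ h2 hQ.1]
        · have h5 : foldRep N (q + 1) = 1 := by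
            unfold foldRep at h4 ⊢; split_ifs at h4 ⊢ <;> omega
          rw [h4, h5, hT _ hP.1 hP.2, laverStar_self _ (by omega), laverStar_one,
            Nat.mod_eq_of_lt h2]
      · have h3 : foldRep N (p + 1) = 1 := by
          unfold foldRep at h2 ⊢; split_ifs at h2 ⊢ <;> omega
        have h6 : 1 ≤ foldRep N (q + 1) := by unfold foldRep; split_ifs <;> omega
        rw [h3, h2, laverStar_self _ hQ.1, laverStar_self _ h6, laverStar_one]
        rcases hQ.2.lt_or_eq with h4 | h4
        · rw [Nat.mod_eq_of_lt h4]
          unfold foldRep at h4 ⊢; split_ifs at h4 ⊢ <;> omega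
        · rw [h4, Nat.mod_self]
          unfold foldRep at h4 ⊢; split_ifs at h4 ⊢ <;> omega

theorem laverStar_periodic {N p t : ℕ} (hp : p < N) (ht : 1 ≤ t) (h : laverStar N p t = N) :
    ∀ q, 1 ≤ q → laverStar N p (t + q) = laverStar N p q := by
  intro q hq
  induction q, hq using Nat.le_induction with
  | base =>
    rw [laverStar_succ hp ht, h, laverStar_self _ (by omega), laverStar_one, Nat.mod_eq_of_lt hp]
  | succ q hq ih =>
    rw [← add_assoc, laverStar_succ hp (by omega), ih, laverStar_succ hp hq]

theorem laverStar_top_of_dvd {N p t : ℕ} (hp : p ≤ N) (hN : 1 ≤ N) (ht : 1 ≤ t) (hd : t ∣ N)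
    (h : laverStar N p t = N) : laverStar N p N = N := by
  rcases hp.lt_or_eq with hp | rfl
  swap
  · exact laverStar_self _ hN
  obtain ⟨c, hc⟩ := hd
  have hc1 : 1 ≤ c := by
    rcases Nat.eq_zero_or_pos c with rfl | h
    · omega
    · exact h
  have key : laverStar N p (t * c) = N := by
    clear hc
    induction c, hc1 using Nat.le_induction with
    | base => simpa using h
    | succ c hc ih =>
      rw [Nat.mul_succ, add_comm, laverStar_periodic hp ht h _ (Nat.mul_pos ht hc), ih]
  rwa [← hc] at key

/-- The table of size `N = 2 ^ n`: the first `t` with `p ⋆ t = N` divides `N`. -/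
theorem laverStar_two_pow (n : ℕ) : ∀ p, 1 ≤ p → p ≤ 2 ^ n → ∃ t, 1 ≤ t ∧ t ∣ 2 ^ n ∧
    laverStar (2 ^ n) p t = 2 ^ n ∧ ∀ j, 1 ≤ j → j < t → laverStar (2 ^ n) p j ≠ 2 ^ n := by
  induction n with
  | zero =>
    intro p h1 h2
    obtain rfl : p = 1 := by simp at h2; omega
    exact ⟨1, le_rfl, by simp, by simp [laverStar_one], by intros; omega⟩
  | succ n ih =>
    rw [pow_succ, mul_comm]
    have hN : 1 ≤ 2 ^ n := Nat.one_le_two_pow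
    generalize 2 ^ n = N at ih hN
    have hT : ∀ p, 1 ≤ p → p ≤ N → laverStar N p N = N := by
      intro p h1 h2
      obtain ⟨t, ht, hd, h, -⟩ := ih p h1 h2
      exact laverStar_top_of_dvd h2 hN ht hd h
    have hF := fun p => laverStar_foldRep hN hT (2 * N - p) p le_rfl
    intro p hp hpN
    rcases hpN.lt_or_eq with hlt | rfl
    swap
    · refine ⟨2 * N, by omega, dvd_rfl, laverStar_self _ (by omega), fun j h1 h2 => ?_⟩
      rw [laverStar_self _ h1]; omega
    have hP : 1 ≤ foldRep N p ∧ foldRep N p ≤ N := by unfold foldRep; split_ifs <;> omega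
    obtain ⟨t, ht, hd, h, hm⟩ := ih _ hP.1 hP.2
    have htN := Nat.le_of_dvd hN hd
    have hlow : ∀ j, 1 ≤ j → j < t → laverStar (2 * N) p j ≠ 2 * N := by
      intro j h1 h2 h3
      have := hF p hp hpN j h1 (by omega)
      have hj : foldRep N j = j := by unfold foldRep; split_ifs <;> omega
      rw [h3, hj] at this
      apply hm j h1 h2
      rw [← this]; unfold foldRep; split_ifs <;> omega
    have hft := hF p hp hpN t ht (by omega)
    have hjt : foldRep N t = t := by unfold foldRep; split_ifs <;> omega
    rw [hjt, h] at hft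
    have hg := laverStar_gt (2 * N) _ p t le_rfl hlt ht
    by_cases hc : laverStar (2 * N) p t = 2 * N
    · exact ⟨t, ht, hd.mul_left 2, hc, hlow⟩
    have hb : laverStar (2 * N) p t = N := by
      unfold foldRep at hft; split_ifs at hft <;> omega
    have hpN' : p < N := by omega
    have hPp : foldRep N p = p := by unfold foldRep; split_ifs <;> omega
    rw [hPp] at h hm
    have hdt : t = N ∨ 2 * t ≤ N := by
      obtain ⟨c, rfl⟩ := hd
      rcases c with _ | _ | c
      · omega
      · left; omega
      · right; nlinarith
    have hmid : ∀ j, 1 ≤ j → j ≤ t →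
        foldRep N (laverStar (2 * N) p (t + j)) = laverStar N p j := by
      intro j h1 h2
      rw [hF p hp hpN (t + j) (by omega) (by omega), hPp]
      rcases hdt with h3 | h3
      · have : foldRep N (t + j) = j := by unfold foldRep; split_ifs <;> omega
        rw [this]
      · have : foldRep N (t + j) = t + j := by unfold foldRep; split_ifs <;> omega
        rw [this, laverStar_periodic hpN' ht h j h1]
    have hhigh : ∀ j, 1 ≤ j → j < t → laverStar (2 * N) p (t + j) ≠ 2 * N := by
      intro j h1 h2 h3
      apply hm j h1 h2
      rw [← hmid j h1 h2.le, h3]; unfold foldRep; split_ifs <;> omega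
    have hbig : ∀ j, 1 ≤ j → j ≤ t → N < laverStar (2 * N) p (t + j) := by
      intro j h1
      induction j, h1 using Nat.le_induction with
      | base =>
        intro _
        rw [laverStar_succ hlt ht, hb]
        exact (laverStar_gt (2 * N) _ N (p + 1) le_rfl (by omega) (by omega)).1
      | succ j h1 ihj =>
        intro h2
        have h3 := ihj (by omega)
        have h4 := hhigh j h1 (by omega)
        have h5 := laverStar_gt (2 * N) _ p (t + j) le_rfl hlt (by omega)
        rw [← add_assoc, laverStar_succ hlt (by omega)]
        have := (laverStar_gt (2 * N) _ (laverStar (2 * N) p (t + j)) (p + 1) le_rfl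
          (by omega) (by omega)).1
        omega
    refine ⟨2 * t, by omega, Nat.mul_dvd_mul_left 2 hd, ?_, ?_⟩
    · have h1 := hmid t ht le_rfl
      have h2 := hbig t ht le_rfl
      rw [h] at h1
      rw [two_mul t]
      unfold foldRep at h1; split_ifs at h1 <;> omega
    · intro j h1 h2
      rcases lt_trichotomy j t with h3 | h3 | h3
      · exact hlow j h1 h3
      · rw [h3]; exact hc
      · obtain ⟨i, rfl⟩ := Nat.exists_eq_add_of_lt h3
        exact hhigh (i + 1) (by omega) (by omega)

/-- `p ⋆ N = N` for `N = 2 ^ n`. -/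
theorem laverStar_top {n p : ℕ} (h1 : 1 ≤ p) (h2 : p ≤ 2 ^ n) :
    laverStar (2 ^ n) p (2 ^ n) = 2 ^ n := by
  obtain ⟨t, ht, hd, h, -⟩ := laverStar_two_pow n p h1 h2
  exact laverStar_top_of_dvd h2 Nat.one_le_two_pow ht hd h

/-- For `N = 2 ^ n` the law `p ⋆ (q ⋆ 1) = (p ⋆ q) ⋆ (p ⋆ 1)` holds for all `p, q`. -/
theorem laverStar_law_two_pow {n p q : ℕ} (hp : p ∈ Set.Icc 1 (2 ^ n))
    (hq : q ∈ Set.Icc 1 (2 ^ n)) :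
    laverStar (2 ^ n) p (laverStar (2 ^ n) q 1)
      = laverStar (2 ^ n) (laverStar (2 ^ n) p q) (laverStar (2 ^ n) p 1) := by
  rcases hq.2.lt_or_eq with h | rfl
  · exact laverStar_law hp hq.1 h
  · rw [laverStar_top hp.1 hp.2, laverStar_self _ le_rfl, laverStar_self]
    rw [laverStar_one]; omega

/-- `p ↦ p + N` is a homomorphism from the table of size `N = 2 ^ n` to that of size `2N`. -/
theorem laverStar_shift {n p q : ℕ} (hp : 1 ≤ p) (hpN : p ≤ 2 ^ n) (hq : 1 ≤ q)
    (hqN : q ≤ 2 ^ n) :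
    laverStar (2 ^ (n + 1)) (p + 2 ^ n) (q + 2 ^ n) = laverStar (2 ^ n) p q + 2 ^ n := by
  have hT : ∀ p, 1 ≤ p → p ≤ 2 ^ n → laverStar (2 ^ n) p (2 ^ n) = 2 ^ n :=
    fun p h1 h2 => laverStar_top h1 h2
  rw [pow_succ, mul_comm]
  generalize 2 ^ n = N at hT hpN hqN
  rcases hpN.lt_or_eq with h | rfl
  swap
  · rw [← two_mul, laverStar_self _ (by omega), laverStar_self _ hq]
  have h1 := laverStar_foldRep (by omega) hT _ (p + N) le_rfl (by omega) (by omega) (q + N)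
    (by omega) (by omega)
  have h2 := laverStar_gt (2 * N) _ (p + N) (q + N) le_rfl (by omega) (by omega)
  have h3 : foldRep N (p + N) = p := by unfold foldRep; split_ifs <;> omega
  have h4 : foldRep N (q + N) = q := by unfold foldRep; split_ifs <;> omega
  rw [h3, h4] at h1
  unfold foldRep at h1; split_ifs at h1 <;> omega

/-- The backwards Laver operation `p * q = N - (N - p) ⋆ (N - q)` on the nonnegative integers,
where `N = 2 ^ n` is a power of two with `p, q < N`.  The least such `N` is taken; every other one
gives the same value (`backStar_eq`). -/
def backStar (p q : ℕ) : ℕ :=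
  2 ^ Nat.size (max p q) -
    laverStar (2 ^ Nat.size (max p q)) (2 ^ Nat.size (max p q) - p) (2 ^ Nat.size (max p q) - q)

/-- The value of `p * q` does not depend on the choice of `N = 2 ^ n` with `p, q < N`. -/
theorem backStar_eq {n p q : ℕ} (hp : p < 2 ^ n) (hq : q < 2 ^ n) :
    backStar p q = 2 ^ n - laverStar (2 ^ n) (2 ^ n - p) (2 ^ n - q) := by
  have hm : max p q < 2 ^ Nat.size (max p q) := Nat.lt_size_self _
  have hle : Nat.size (max p q) ≤ n := Nat.size_le.2 (max_lt hp hq)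
  unfold backStar
  generalize Nat.size (max p q) = m at hm hle
  have hm' := max_lt_iff.1 hm
  clear hp hq
  induction n, hle using Nat.le_induction with
  | base => rfl
  | succ n hle ih =>
    have h1 : 2 ^ m ≤ 2 ^ n := Nat.pow_le_pow_right (by norm_num) hle
    have h2 := laverStar_shift (n := n) (p := 2 ^ n - p) (q := 2 ^ n - q) (by omega) (by omega)
      (by omega) (by omega)
    have h3 : 2 ^ (n + 1) = 2 ^ n + 2 ^ n := by rw [pow_succ]; omega
    rw [ih]
    have h4 : 2 ^ (n + 1) - p = 2 ^ n - p + 2 ^ n := by omega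
    have h5 : 2 ^ (n + 1) - q = 2 ^ n - q + 2 ^ n := by omega
    rw [h4, h5, h2]
    omega

/-- `t` is the period of the row of `p`: the least positive integer with `p * (q + t) = p * q`
for all `q ≥ 0`. -/
def IsRowPeriod (p t : ℕ) : Prop :=
  IsLeast {s : ℕ | 0 < s ∧ ∀ q : ℕ, backStar p (q + s) = backStar p q} t

/-! Put `D = 2^n`. Modulo `2^(2D)` the backwards operation is `-((-p) ⋆ (-q))`, and both sides of
the claim are below `2^(2D)`. So the claim is `(2^D a - 1) ⋆ s = 2^D ((a - 1) ⋆ s)` in the table of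
order `2^(2D)`. By induction on `s` this holds once multiplication by `2^D` is an endomorphism of
that table (`RowShift.mul_laverOp_mul`). By distributivity, the latter reduces to `(2^D a) ⋆ 2^D =
2^D (a + 1)`: the row of a multiple of `2^D` starts with steps of 1 (`RowShift`).

`rowShift_and_splitsPower` proves, by doubling `D = 2^d`, that such initial segments occur modulo
`2^(ρ + D)` for every multiple `ρ` of `D`. They occur as soon as the relevant rows have period
dividing `2^ρ`, so one needs `p ⋆ 2^R` to be highly divisible by 2. For this, `2^R` is written, up
to a unit, as `u ⋆ v` with `2^C ∣ p ⋆ v` and `¬ 2^C ∣ p ⋆ u`. Then `p ⋆ (u ⋆ v) = (p ⋆ u) ⋆ (p ⋆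
v)`, and the row of `p ⋆ u` is controlled either by a known bound on periods or by descending
induction, since `p ⋆ u` is larger than `p`. `SplitsPower` provides `u` and `v`; its source is the
identity `RowShift.exact`. -/

/-! ### Projections between the tables. -/

/-- Iterates `laverStar_foldRep`, which halves the order of the table. -/
theorem laverStar_modEq {c m : ℕ} (h : c ≤ m) : ∀ {p q p' q' : ℕ},
    p ∈ Set.Icc 1 (2 ^ m) → q ∈ Set.Icc 1 (2 ^ m) → p' ∈ Set.Icc 1 (2 ^ c) →
    q' ∈ Set.Icc 1 (2 ^ c) → p ≡ p' [MOD 2 ^ c] → q ≡ q' [MOD 2 ^ c] →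
    laverStar (2 ^ m) p q ≡ laverStar (2 ^ c) p' q' [MOD 2 ^ c] := by
  induction m, h using Nat.le_induction with
  | base =>
    intro p q p' q' hp hq hp' hq' h1 h2
    have key : ∀ {a b : ℕ}, a ∈ Set.Icc 1 (2 ^ c) → b ∈ Set.Icc 1 (2 ^ c) →
        a ≡ b [MOD 2 ^ c] → a = b := by
      intro a b ha hb hab
      have h3 : (a - 1) + 1 ≡ (b - 1) + 1 [MOD 2 ^ c] := by
        rwa [Nat.sub_add_cancel ha.1, Nat.sub_add_cancel hb.1]
      have h4 := Nat.ModEq.eq_of_lt_of_lt (Nat.ModEq.add_right_cancel' 1 h3)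
        (by have := ha.2; have := ha.1; omega) (by have := hb.2; have := hb.1; omega)
      have := ha.1; have := hb.1; omega
    rw [key hp hp' h1, key hq hq' h2]
  | succ m h ih =>
    intro p q p' q' hp hq hp' hq' h1 h2
    have hN : 1 ≤ 2 ^ m := Nat.one_le_two_pow
    have hf : ∀ x, foldRep (2 ^ m) x ≡ x [MOD 2 ^ c] := by
      intro x
      unfold foldRep
      split_ifs with hx
      · rfl
      · refine ((Nat.modEq_iff_dvd' (Nat.sub_le _ _)).2 ?_)
        rw [Nat.sub_sub_self (by omega)]
        exact pow_dvd_pow 2 h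
    have hfm : ∀ x ∈ Set.Icc 1 (2 ^ (m + 1)), foldRep (2 ^ m) x ∈ Set.Icc 1 (2 ^ m) := by
      intro x hx
      have h1 := hx.1
      have h2 := hx.2
      rw [pow_succ] at h2
      unfold foldRep
      split_ifs <;> constructor <;> omega
    have h3 := ih (hfm p hp) (hfm q hq) hp' hq' ((hf p).trans h1) ((hf q).trans h2)
    rw [← laverStar_foldRep hN (fun p h1 h2 => laverStar_top h1 h2) _ p le_rfl hp.1
      (by have := hp.2; rw [pow_succ] at this; omega) q hq.1
      (by have := hq.2; rw [pow_succ] at this; omega)] at h3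
    have h4 := (hf _).symm.trans h3
    rwa [← pow_succ'] at h4

/-! ### The table as an operation on `ZMod (2 ^ m)`. -/

/-- The Laver table of order `2 ^ m` on the residues modulo `2 ^ m`. -/
def laverOp {m : ℕ} (p q : ZMod (2 ^ m)) : ZMod (2 ^ m) :=
  (laverStar (2 ^ m) (2 ^ m - (-p).val) (2 ^ m - (-q).val) : ℕ)

local infixl:70 " ⋆ " => laverOp

section LaverOp
variable {m : ℕ}

/-- The double negation in `2 ^ m - (-x).val` makes `2 ^ m`, not 0, the representative of the class
of 0. -/
theorem neg_val_sub_mem (x : ZMod (2 ^ m)) : 2 ^ m - (-x).val ∈ Set.Icc 1 (2 ^ m) := by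
  have := ZMod.val_lt (-x)
  constructor <;> omega

theorem natCast_sub_neg_val (x : ZMod (2 ^ m)) : ((2 ^ m - (-x).val : ℕ) : ZMod (2 ^ m)) = x := by
  rw [Nat.cast_sub (ZMod.val_lt (-x)).le, ZMod.natCast_self, ZMod.natCast_val, ZMod.cast_id]
  simp

theorem sub_neg_val_natCast {k : ℕ} (hk : k ∈ Set.Icc 1 (2 ^ m)) :
    2 ^ m - (-(k : ZMod (2 ^ m))).val = k := by
  have h : (-(k : ZMod (2 ^ m))) = ((2 ^ m - k : ℕ) : ZMod (2 ^ m)) := by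
    rw [Nat.cast_sub hk.2, ZMod.natCast_self, zero_sub]
  have h1 := hk.1
  have h2 := hk.2
  rw [h, ZMod.val_natCast, Nat.mod_eq_of_lt (by omega)]
  omega

theorem exists_natCast_eq (x : ZMod (2 ^ m)) : ∃ k : ℕ, k ∈ Set.Icc 1 (2 ^ m) ∧
    (k : ZMod (2 ^ m)) = x :=
  ⟨_, neg_val_sub_mem x, natCast_sub_neg_val x⟩

theorem laverOp_natCast {k l : ℕ} (hk : k ∈ Set.Icc 1 (2 ^ m)) (hl : l ∈ Set.Icc 1 (2 ^ m)) :
    (k : ZMod (2 ^ m)) ⋆ (l : ZMod (2 ^ m)) = (laverStar (2 ^ m) k l : ℕ) := by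
  rw [laverOp, sub_neg_val_natCast hk, sub_neg_val_natCast hl]

theorem two_pow_mem : 2 ^ m ∈ Set.Icc 1 (2 ^ m) := ⟨Nat.one_le_two_pow, le_rfl⟩

theorem one_mem : 1 ∈ Set.Icc 1 (2 ^ m) := ⟨le_rfl, Nat.one_le_two_pow⟩

theorem natCast_two_pow_self : ((2 ^ m : ℕ) : ZMod (2 ^ m)) = 0 := ZMod.natCast_self _

theorem laverOp_one (p : ZMod (2 ^ m)) : p ⋆ 1 = p + 1 := by
  obtain ⟨k, hk, rfl⟩ := exists_natCast_eq p
  have := laverOp_natCast hk one_mem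
  rw [Nat.cast_one] at this
  rw [this, laverStar_one, Nat.cast_add, ZMod.natCast_mod, Nat.cast_one]

theorem zero_laverOp (q : ZMod (2 ^ m)) : 0 ⋆ q = q := by
  obtain ⟨k, hk, rfl⟩ := exists_natCast_eq q
  have := laverOp_natCast two_pow_mem hk
  rw [natCast_two_pow_self] at this
  rw [this, laverStar_self _ hk.1]

theorem laverOp_zero (p : ZMod (2 ^ m)) : p ⋆ 0 = 0 := by
  obtain ⟨k, hk, rfl⟩ := exists_natCast_eq p
  have := laverOp_natCast hk two_pow_mem
  rw [natCast_two_pow_self] at this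
  rw [this, laverStar_top hk.1 hk.2, natCast_two_pow_self]

theorem laverOp_add_one (p q : ZMod (2 ^ m)) : p ⋆ (q + 1) = (p ⋆ q) ⋆ (p + 1) := by
  rw [← laverOp_one q, ← laverOp_one p]
  obtain ⟨k, hk, rfl⟩ := exists_natCast_eq p
  obtain ⟨l, hl, rfl⟩ := exists_natCast_eq q
  rw [← Nat.cast_one, laverOp_natCast hl one_mem, laverOp_natCast hk one_mem, laverOp_natCast hk hl,
    laverOp_natCast hk (laverStar_mem hl one_mem),
    laverOp_natCast (laverStar_mem hk hl) (laverStar_mem hk one_mem), laverStar_law_two_pow hk hl]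

theorem two_pow_eq_zero {c : ℕ} (h : m ≤ c) : (2 : ZMod (2 ^ m)) ^ c = 0 := by
  obtain ⟨d, rfl⟩ := Nat.exists_eq_add_of_le h
  have := @natCast_two_pow_self m
  push_cast at this
  rw [pow_add, this, zero_mul]

theorem two_pow_dvd_natCast_sub {c : ℕ} (h : c ≤ m) (a b : ℕ) :
    (2 : ZMod (2 ^ m)) ^ c ∣ (a : ZMod (2 ^ m)) - b ↔ a ≡ b [MOD 2 ^ c] := by
  have hd : ((2 ^ c : ℕ) : ℤ) ∣ ((2 ^ m : ℕ) : ℤ) := by exact_mod_cast pow_dvd_pow 2 h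
  constructor
  · rintro ⟨u, hu⟩
    have h1 : ((a - b - 2 ^ c * u.val : ℤ) : ZMod (2 ^ m)) = 0 := by
      push_cast
      rw [hu, ZMod.natCast_val, ZMod.cast_id]
      simp
    have h2 := hd.trans ((ZMod.intCast_zmod_eq_zero_iff_dvd _ _).1 h1)
    refine (Nat.modEq_iff_dvd.2 ?_).symm
    have h3 : ((2 ^ c : ℕ) : ℤ) ∣ 2 ^ c * (u.val : ℤ) := by
      push_cast
      exact dvd_mul_right _ _
    simpa using dvd_add h2 h3
  · intro hab
    obtain ⟨k, hk⟩ := Nat.modEq_iff_dvd.1 hab.symm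
    refine ⟨(k : ZMod (2 ^ m)), ?_⟩
    have := congrArg (Int.cast : ℤ → ZMod (2 ^ m)) hk
    push_cast at this
    exact this

theorem two_pow_dvd_iff_val (c : ℕ) (x : ZMod (2 ^ m)) :
    (2 : ZMod (2 ^ m)) ^ c ∣ x ↔ x.val % 2 ^ c = 0 := by
  rcases le_total c m with h | h
  · have := two_pow_dvd_natCast_sub h x.val 0
    rw [ZMod.natCast_val, ZMod.cast_id] at this
    simpa [Nat.ModEq] using this
  · rw [two_pow_eq_zero h, zero_dvd_iff, Nat.mod_eq_of_lt, ZMod.val_eq_zero]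
    exact (ZMod.val_lt x).trans_le (Nat.pow_le_pow_right (by norm_num) h)

/-! ### Congruences modulo `2 ^ c`; for `c ≥ m` they are equalities. -/

/-- Congruence modulo `2 ^ c` in `ZMod (2 ^ m)`. -/
def PowCong (c : ℕ) (x y : ZMod (2 ^ m)) : Prop := (2 : ZMod (2 ^ m)) ^ c ∣ x - y

theorem PowCong.refl {c : ℕ} (x : ZMod (2 ^ m)) : PowCong c x x := by simp [PowCong]

theorem PowCong.symm {c : ℕ} {x y : ZMod (2 ^ m)} (h : PowCong c x y) : PowCong c y x := by
  simpa [PowCong] using (dvd_neg.2 h)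

theorem PowCong.trans {c : ℕ} {x y z : ZMod (2 ^ m)} (h : PowCong c x y) (h' : PowCong c y z) :
    PowCong c x z := by
  simpa [PowCong] using dvd_add h h'

theorem PowCong.add {c : ℕ} {x y x' y' : ZMod (2 ^ m)} (h : PowCong c x y)
    (h' : PowCong c x' y') : PowCong c (x + x') (y + y') := by
  have := dvd_add h h'
  rwa [sub_add_sub_comm] at this

theorem PowCong.add_right {c : ℕ} {x y : ZMod (2 ^ m)} (h : PowCong c x y) (z : ZMod (2 ^ m)) :
    PowCong c (x + z) (y + z) := h.add (.refl z)

theorem PowCong.mono {c c' : ℕ} (hc : c' ≤ c) {x y : ZMod (2 ^ m)} (h : PowCong c x y) :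
    PowCong c' x y := (pow_dvd_pow 2 hc).trans h

theorem PowCong.dvd_iff {c : ℕ} {x y : ZMod (2 ^ m)} (h : PowCong c x y) :
    (2 : ZMod (2 ^ m)) ^ c ∣ x ↔ (2 : ZMod (2 ^ m)) ^ c ∣ y :=
  (dvd_iff_dvd_of_dvd_sub h)

theorem powCong_zero {c : ℕ} {x : ZMod (2 ^ m)} : PowCong c x 0 ↔ (2 : ZMod (2 ^ m)) ^ c ∣ x := by
  simp [PowCong]

theorem exists_mem_modEq (c k : ℕ) : ∃ l ∈ Set.Icc 1 (2 ^ c), k ≡ l [MOD 2 ^ c] := by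
  have h : 0 < 2 ^ c := by positivity
  rcases Nat.eq_zero_or_pos (k % 2 ^ c) with h0 | h0
  · exact ⟨2 ^ c, two_pow_mem, by simp [Nat.ModEq, h0]⟩
  · exact ⟨k % 2 ^ c, ⟨h0, (Nat.mod_lt _ h).le⟩, (Nat.mod_modEq _ _).symm⟩

theorem PowCong.laverOp {c : ℕ} {p q p' q' : ZMod (2 ^ m)} (h : PowCong c p p')
    (h' : PowCong c q q') : PowCong c (p ⋆ q) (p' ⋆ q') := by
  rcases le_total c m with hc | hc
  · obtain ⟨k, hk, rfl⟩ := exists_natCast_eq p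
    obtain ⟨l, hl, rfl⟩ := exists_natCast_eq q
    obtain ⟨k', hk', rfl⟩ := exists_natCast_eq p'
    obtain ⟨l', hl', rfl⟩ := exists_natCast_eq q'
    rw [PowCong, two_pow_dvd_natCast_sub hc] at h h'
    rw [laverOp_natCast hk hl, laverOp_natCast hk' hl', PowCong, two_pow_dvd_natCast_sub hc]
    obtain ⟨a, ha, hka⟩ := exists_mem_modEq c k
    obtain ⟨b, hb, hlb⟩ := exists_mem_modEq c l
    exact (laverStar_modEq hc hk hl ha hb hka hlb).trans
      (laverStar_modEq hc hk' hl' ha hb (h.symm.trans hka) (h'.symm.trans hlb)).symm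
  · rw [PowCong, two_pow_eq_zero hc, zero_dvd_iff, sub_eq_zero] at h h'
    rw [h, h']
    exact .refl _

theorem PowCong.laverOp_left {c : ℕ} {p p' : ZMod (2 ^ m)} (h : PowCong c p p')
    (q : ZMod (2 ^ m)) : PowCong c (p ⋆ q) (p' ⋆ q) := h.laverOp (.refl q)

theorem PowCong.laverOp_right {c : ℕ} {q q' : ZMod (2 ^ m)} (h : PowCong c q q')
    (p : ZMod (2 ^ m)) : PowCong c (p ⋆ q) (p ⋆ q') := (PowCong.refl p).laverOp h

/-- Modulo `2 ^ c`, rows are larger than their index. -/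
theorem val_mod_lt_laverOp {c : ℕ} {p q : ZMod (2 ^ m)} (hp : ¬ (2 : ZMod (2 ^ m)) ^ c ∣ p)
    (hpq : ¬ (2 : ZMod (2 ^ m)) ^ c ∣ p ⋆ q) : p.val % 2 ^ c < (p ⋆ q).val % 2 ^ c := by
  wlog hc : c ≤ m generalizing c
  · have h2 : (2 : ZMod (2 ^ m)) ^ c = 2 ^ m := by
      rw [two_pow_eq_zero (by omega), two_pow_eq_zero le_rfl]
    rw [h2] at hp hpq
    have := this hp hpq le_rfl
    have h3 : ∀ x : ZMod (2 ^ m), x.val % 2 ^ c = x.val % 2 ^ m := by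
      intro x
      have := ZMod.val_lt x
      have h4 : 2 ^ m ≤ 2 ^ c := Nat.pow_le_pow_right (by norm_num) (by omega)
      rw [Nat.mod_eq_of_lt this, Nat.mod_eq_of_lt (by omega)]
    rwa [h3, h3]
  rw [two_pow_dvd_iff_val] at hp hpq
  obtain ⟨k, hk, rfl⟩ := exists_natCast_eq p
  obtain ⟨l, hl, rfl⟩ := exists_natCast_eq q
  rw [laverOp_natCast hk hl] at hpq ⊢
  have hv : ∀ a : ℕ, (a : ZMod (2 ^ m)).val % 2 ^ c = a % 2 ^ c := by
    intro a
    rw [ZMod.val_natCast, Nat.mod_mod_of_dvd _ (pow_dvd_pow 2 hc)]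
  rw [hv] at hp hpq ⊢
  rw [hv]
  have hlt : k % 2 ^ c < 2 ^ c := Nat.mod_lt _ (by positivity)
  obtain ⟨b, hb, hlb⟩ := exists_mem_modEq c l
  have h1 := laverStar_modEq hc hk hl (p' := k % 2 ^ c) ⟨by omega, hlt.le⟩ hb
    (Nat.mod_modEq _ _).symm hlb
  have h2 := laverStar_gt (2 ^ c) _ (k % 2 ^ c) b le_rfl hlt hb.1
  rw [Nat.ModEq] at h1
  rw [h1] at hpq ⊢
  rcases h2.2.lt_or_eq with h3 | h3
  · rw [Nat.mod_eq_of_lt h3]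
    exact h2.1
  · rw [h3, Nat.mod_self] at hpq
    exact absurd rfl hpq

theorem val_lt_laverOp {p q : ZMod (2 ^ m)} (hp : p ≠ 0) (hpq : p ⋆ q ≠ 0) :
    p.val < (p ⋆ q).val := by
  have h0 := two_pow_eq_zero (le_refl m)
  have := val_mod_lt_laverOp (c := m) (p := p) (q := q) (by rwa [h0, zero_dvd_iff])
    (by rwa [h0, zero_dvd_iff])
  rwa [Nat.mod_eq_of_lt (ZMod.val_lt _), Nat.mod_eq_of_lt (ZMod.val_lt _)] at this

theorem zmod_induction {motive : ZMod (2 ^ m) → Prop} (zero : motive 0)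
    (add_one : ∀ x, motive x → motive (x + 1)) (x : ZMod (2 ^ m)) : motive x := by
  have h : ∀ k : ℕ, motive (k : ZMod (2 ^ m)) := by
    intro k
    induction k with
    | zero => simpa using zero
    | succ k ih => simpa using add_one _ ih
  simpa using h x.val

/-! ### Self-distributivity and composition of rows. -/

/-- Left self-distributivity. -/
theorem laverOp_laverOp (p q s : ZMod (2 ^ m)) : p ⋆ (q ⋆ s) = (p ⋆ q) ⋆ (p ⋆ s) := by
  -- Descending induction on `p`, inside it on `q`, and ascending induction on `s`: `p ⋆ q` and `q ⋆
  -- s` are either 0 or larger than `p` and `q` respectively.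
  obtain ⟨k, hk⟩ : ∃ k, 2 ^ m - p.val ≤ k := ⟨_, le_rfl⟩
  induction k generalizing p q s with
  | zero => have := ZMod.val_lt p; omega
  | succ k ihp =>
    by_cases hp : p = 0
    · simp [hp, zero_laverOp]
    have hP : ∀ q s t : ZMod (2 ^ m), (p ⋆ q) ⋆ (s ⋆ t) = ((p ⋆ q) ⋆ s) ⋆ ((p ⋆ q) ⋆ t) := by
      intro q s t
      by_cases hq : p ⋆ q = 0
      · simp [hq, zero_laverOp]
      · have := val_lt_laverOp hp hq
        exact ihp _ _ _ (by omega)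
    obtain ⟨l, hl⟩ : ∃ l, 2 ^ m - q.val ≤ l := ⟨_, le_rfl⟩
    induction l generalizing q s with
    | zero => have := ZMod.val_lt q; omega
    | succ l ihq =>
      by_cases hq : q = 0
      · simp [hq, laverOp_zero, zero_laverOp]
      induction s using zmod_induction with
      | zero => simp [laverOp_zero]
      | add_one s ih =>
        have h1 : p ⋆ ((q ⋆ s) ⋆ (q + 1)) = (p ⋆ (q ⋆ s)) ⋆ (p ⋆ (q + 1)) := by
          by_cases hqs : q ⋆ s = 0
          · simp [hqs, laverOp_zero, zero_laverOp]
          · have := val_lt_laverOp hq hqs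
            exact ihq _ _ (by omega)
        rw [laverOp_add_one q s, h1, ih, laverOp_add_one p q, ← hP, ← laverOp_add_one]

/-- The composite of the rows of `p` and `q` is again a row, that of `p ∘ q = p ⋆ (q + 1) - 1`. -/
theorem comp_laverOp (p q s : ZMod (2 ^ m)) : (p ⋆ (q + 1) - 1) ⋆ s = p ⋆ (q ⋆ s) := by
  induction s using zmod_induction with
  | zero => simp [laverOp_zero]
  | add_one s ih =>
    rw [laverOp_add_one, ih, sub_add_cancel, ← laverOp_laverOp, ← laverOp_add_one]

/-! ### Periods of rows modulo `2 ^ c`. -/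

theorem laverOp_add_of_dvd {c : ℕ} {p s : ZMod (2 ^ m)} (h : (2 : ZMod (2 ^ m)) ^ c ∣ p ⋆ s)
    (j : ZMod (2 ^ m)) : PowCong c (p ⋆ (s + j)) (p ⋆ j) := by
  induction j using zmod_induction with
  | zero => simpa [laverOp_zero, powCong_zero] using h
  | add_one j ih =>
    rw [← add_assoc, laverOp_add_one p, laverOp_add_one p]
    exact ih.laverOp_left _

/-- The zeros of a row modulo `2 ^ c` are closed under multiples. Hence `2 ^ c ∣ p ⋆ 2 ^ x` says
that the period of `p` modulo `2 ^ c` divides `2 ^ x`. -/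
theorem dvd_laverOp_of_dvd {c : ℕ} {p q s : ZMod (2 ^ m)} (h : (2 : ZMod (2 ^ m)) ^ c ∣ p ⋆ q)
    (hqs : q ∣ s) : (2 : ZMod (2 ^ m)) ^ c ∣ p ⋆ s := by
  obtain ⟨k, rfl⟩ := hqs
  induction k using zmod_induction with
  | zero => simp [laverOp_zero]
  | add_one k ih =>
    rw [mul_add, mul_one, add_comm]
    exact (laverOp_add_of_dvd h _).dvd_iff.2 ih

theorem dvd_laverOp {c : ℕ} (p : ZMod (2 ^ m)) {q : ZMod (2 ^ m)}
    (hq : (2 : ZMod (2 ^ m)) ^ c ∣ q) : (2 : ZMod (2 ^ m)) ^ c ∣ p ⋆ q := by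
  have h := (powCong_zero.2 hq).laverOp_right p
  rwa [laverOp_zero, powCong_zero] at h

theorem isUnit_one_add_two_mul (u : ZMod (2 ^ m)) : IsUnit (1 + 2 * u) := by
  refine IsNilpotent.isUnit_one_add ⟨m, ?_⟩
  rw [mul_pow, two_pow_eq_zero le_rfl, zero_mul]

/-- The odd part of `j` is a unit, so only its 2-adic valuation matters, and that is at most `x`. -/
theorem natCast_dvd_two_pow {j x : ℕ} (hj : 0 < j) (hjx : j < 2 ^ (x + 1)) :
    (j : ZMod (2 ^ m)) ∣ 2 ^ x := by
  obtain ⟨v, k, hk, rfl⟩ := Nat.exists_eq_two_pow_mul_odd hj.ne'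
  obtain ⟨u, rfl⟩ := hk
  have hv : v ≤ x := by
    have h1 : 2 ^ v < 2 ^ (x + 1) :=
      (Nat.le_mul_of_pos_right _ (by omega)).trans_lt hjx
    have := (Nat.pow_lt_pow_iff_right (by norm_num)).1 h1
    omega
  push_cast
  rw [add_comm ((2 : ZMod (2 ^ m)) * u), (isUnit_one_add_two_mul _).mul_right_dvd]
  exact pow_dvd_pow 2 hv

theorem PowCong.dvd_two_pow {c : ℕ} {y : ZMod (2 ^ m)} (h : PowCong (c + 1) y (2 ^ c)) :
    y ∣ 2 ^ c := by
  obtain ⟨u, hu⟩ := h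
  have : y = 2 ^ c * (1 + 2 * u) := by linear_combination hu
  rw [this, (isUnit_one_add_two_mul _).mul_right_dvd]

/-- Doubling the modulus at most doubles the period. Otherwise the row has no zero modulo `2 ^ (c +
1)` from `2 ^ x` to `2 ^ (x + 1)`, so it increases strictly there; but both end values are nonzero
multiples of `2 ^ c` modulo `2 ^ (c + 1)`, hence equal. -/
theorem two_pow_dvd_laverOp_succ {c x : ℕ} {p : ZMod (2 ^ m)}
    (h : (2 : ZMod (2 ^ m)) ^ c ∣ p ⋆ 2 ^ x) :
    (2 : ZMod (2 ^ m)) ^ (c + 1) ∣ p ⋆ 2 ^ (x + 1) := by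
  by_cases h1 : (2 : ZMod (2 ^ m)) ^ (c + 1) ∣ p ⋆ 2 ^ x
  · exact dvd_laverOp_of_dvd h1 (pow_dvd_pow 2 (Nat.le_succ x))
  by_contra h2
  have hn : ∀ j : ℕ, j ≤ 2 ^ x → ¬ (2 : ZMod (2 ^ m)) ^ (c + 1) ∣ p ⋆ (2 ^ x + j) := by
    intro j hj h3
    rcases hj.lt_or_eq with hj | rfl
    · have h4 : ((2 ^ x + j : ℕ) : ZMod (2 ^ m)) ∣ 2 ^ x :=
        natCast_dvd_two_pow (by positivity) (by rw [pow_succ]; omega)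
      push_cast at h4
      exact h1 (dvd_laverOp_of_dvd h3 h4)
    · apply h2
      rw [pow_succ (2 : ZMod (2 ^ m)) x, mul_two]
      rwa [Nat.cast_pow, Nat.cast_ofNat] at h3
  have hlt : ∀ j : ℕ, j < 2 ^ x → (p ⋆ (2 ^ x)).val % 2 ^ (c + 1)
      < (p ⋆ (2 ^ x + (j + 1 : ℕ))).val % 2 ^ (c + 1) := by
    intro j
    induction j with
    | zero =>
      intro hj
      have h3 := hn 1 hj
      rw [Nat.cast_one, laverOp_add_one] at h3
      rw [zero_add, Nat.cast_one, laverOp_add_one]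
      exact val_mod_lt_laverOp h1 h3
    | succ j ih =>
      intro hj
      have h3 := hn (j + 1 + 1) hj
      rw [Nat.cast_succ, ← add_assoc, laverOp_add_one] at h3
      have h4 := val_mod_lt_laverOp (hn (j + 1) (by omega)) h3
      rw [Nat.cast_succ (j + 1), ← add_assoc, laverOp_add_one p]
      exact (ih (by omega)).trans h4
  have h5 := hlt (2 ^ x - 1) (Nat.sub_lt (by positivity) one_pos)
  have h6 : ((2 ^ x - 1 + 1 : ℕ) : ZMod (2 ^ m)) = 2 ^ x := by
    rw [Nat.sub_add_cancel Nat.one_le_two_pow]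
    push_cast
    rfl
  rw [h6, ← mul_two, ← pow_succ] at h5
  have h7 : (2 : ZMod (2 ^ m)) ^ c ∣ p ⋆ 2 ^ (x + 1) :=
    dvd_laverOp_of_dvd h (pow_dvd_pow 2 (Nat.le_succ x))
  rw [two_pow_dvd_iff_val] at h h7 h1
  have h8 : ∀ y : ℕ, y % 2 ^ c = 0 → y % 2 ^ (c + 1) = 0 ∨ y % 2 ^ (c + 1) = 2 ^ c := by
    intro y hy
    have h9 : y % 2 ^ (c + 1) % 2 ^ c = 0 := by
      rw [Nat.mod_mod_of_dvd _ (pow_dvd_pow 2 (Nat.le_succ c)), hy]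
    have h10 : y % 2 ^ (c + 1) < 2 ^ (c + 1) := Nat.mod_lt _ (by positivity)
    obtain ⟨k, hk⟩ := Nat.dvd_of_mod_eq_zero h9
    rw [hk, pow_succ] at h10
    have h11 : k < 2 := Nat.lt_of_mul_lt_mul_left h10
    rw [hk]
    interval_cases k <;> simp
  rcases h8 _ h with h9 | h9 <;> rcases h8 _ h7 with h10 | h10 <;> omega

theorem two_pow_dvd_laverOp_add {c x : ℕ} {p : ZMod (2 ^ m)}
    (h : (2 : ZMod (2 ^ m)) ^ c ∣ p ⋆ 2 ^ x) (k : ℕ) :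
    (2 : ZMod (2 ^ m)) ^ (c + k) ∣ p ⋆ 2 ^ (x + k) := by
  induction k with
  | zero => exact h
  | succ k ih => exact two_pow_dvd_laverOp_succ ih

/-- Otherwise the row has no zero before `2 ^ (c + 1)`, so it increases strictly from a value at
least 2, and its entry at `2 ^ (c + 1) - 1` is too large for a residue. -/
theorem two_pow_dvd_laverOp_half {c : ℕ} {q : ZMod (2 ^ m)}
    (h : ¬ (2 : ZMod (2 ^ m)) ^ (c + 1) ∣ q) :
    (2 : ZMod (2 ^ m)) ^ (c + 1) ∣ q ⋆ 2 ^ c := by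
  by_contra h2
  have hn : ∀ j : ℕ, 0 < j → j < 2 ^ (c + 1) → ¬ (2 : ZMod (2 ^ m)) ^ (c + 1) ∣ q ⋆ j :=
    fun j h0 hj h3 => h2 (dvd_laverOp_of_dvd h3 (natCast_dvd_two_pow h0 hj))
  have hlt : ∀ j : ℕ, j + 1 < 2 ^ (c + 1) →
      j + 1 < (q ⋆ (j + 1 : ℕ)).val % 2 ^ (c + 1) := by
    intro j
    induction j with
    | zero =>
      intro hj
      have h3 := val_mod_lt_laverOp h (hn 1 one_pos hj)
      rw [two_pow_dvd_iff_val] at h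
      simp only [zero_add]
      omega
    | succ j ih =>
      intro hj
      have h3 := hn (j + 1 + 1) (by omega) hj
      rw [Nat.cast_succ, laverOp_add_one] at h3
      have h4 := val_mod_lt_laverOp (hn (j + 1) (by omega) (by omega)) h3
      have := ih (by omega)
      rw [Nat.cast_succ (j + 1), laverOp_add_one]
      omega
  have h1 : 2 ≤ 2 ^ (c + 1) := by rw [pow_succ]; have : 0 < 2 ^ c := by positivity
                                  omega
  have h3 := hlt (2 ^ (c + 1) - 2) (by omega)
  have h4 : (q ⋆ (2 ^ (c + 1) - 2 + 1 : ℕ)).val % 2 ^ (c + 1) < 2 ^ (c + 1) :=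
    Nat.mod_lt _ (by positivity)
  omega

theorem two_pow_dvd_laverOp_pred {c : ℕ} {q : ZMod (2 ^ m)} (h : ¬ (2 : ZMod (2 ^ m)) ^ c ∣ q) :
    (2 : ZMod (2 ^ m)) ^ c ∣ q ⋆ 2 ^ (c - 1) := by
  match c with
  | 0 => simp
  | c + 1 => exact two_pow_dvd_laverOp_half h

theorem two_pow_dvd_laverOp_self {c : ℕ} {q : ZMod (2 ^ m)} (h : ¬ (2 : ZMod (2 ^ m)) ^ c ∣ q) :
    (2 : ZMod (2 ^ m)) ^ (c + 1) ∣ q ⋆ 2 ^ c := by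
  match c with
  | 0 => simp at h
  | c + 1 => exact two_pow_dvd_laverOp_succ (two_pow_dvd_laverOp_half h)

end LaverOp

/-! ### Initial segments of the rows of multiples of `2 ^ r`. -/

/-- Modulo `2 ^ (r + K)`, the row of each multiple `p` of `2 ^ r` starts with
`p + 1, p + 2, …, p + 2 ^ r`. -/
def RowShift (m r K : ℕ) : Prop :=
  ∀ p : ZMod (2 ^ m), 2 ^ r ∣ p → ∀ j : ℕ, 1 ≤ j → j ≤ 2 ^ r → PowCong (r + K) (p ⋆ j) (p + j)

/-- Whenever the period of a row modulo `2 ^ C` lies strictly between `2 ^ ρ` and `2 ^ (ρ + D)`,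
there is an element `2 ^ ρ * b` outside the period which maps some multiple of the period
exactly to `2 ^ (ρ + D)`. -/
def SplitsPower (m D ρ : ℕ) : Prop :=
  ∀ (p : ZMod (2 ^ m)) (C : ℕ), ¬ 2 ^ C ∣ p ⋆ 2 ^ ρ → 2 ^ C ∣ p ⋆ 2 ^ (ρ + D - 1) →
    ∃ (b : ZMod (2 ^ m)) (x : ℕ), PowCong (ρ + D + 1) ((2 ^ ρ * b) ⋆ 2 ^ (ρ + x)) (2 ^ (ρ + D)) ∧
      2 ^ C ∣ p ⋆ 2 ^ (ρ + x) ∧ ¬ 2 ^ C ∣ p ⋆ (2 ^ ρ * b)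

section RowShift
variable {m : ℕ}

theorem RowShift.mono {r K K' : ℕ} (h : RowShift m r K) (hK : K' ≤ K) : RowShift m r K' :=
  fun p hp j h1 h2 => (h p hp j h1 h2).mono (by omega)

/-- Here `p ⋆ (j + 1) ≡ (p + j) ⋆ (p + 1)`, and `p` is a multiple of the period of the row of `p +
j`, so the value is `(p + j) ⋆ 1`. -/
theorem laverOp_natCast_of_dvd {r c : ℕ} {p : ZMod (2 ^ m)} (hp : 2 ^ r ∣ p)
    (h : ∀ i : ℕ, 0 < i → i < 2 ^ r → 2 ^ c ∣ (p + (i : ZMod (2 ^ m))) ⋆ 2 ^ r) {j : ℕ} (h1 : 1 ≤ j)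
    (hj : j ≤ 2 ^ r) : PowCong c (p ⋆ j) (p + j) := by
  induction j, h1 using Nat.le_induction with
  | base => simpa [laverOp_one] using PowCong.refl _
  | succ j h1 ih =>
    rw [Nat.cast_succ, laverOp_add_one]
    refine ((ih (by omega)).laverOp_left _).trans ?_
    refine (laverOp_add_of_dvd (dvd_laverOp_of_dvd (h j h1 (by omega)) hp) 1).trans ?_
    rw [laverOp_one, add_assoc]
    exact .refl _

theorem natCast_not_dvd {r i : ℕ} (hr : r ≤ m) (h0 : 0 < i) (hi : i < 2 ^ r) :
    ¬ (2 : ZMod (2 ^ m)) ^ r ∣ i := by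
  have := two_pow_dvd_natCast_sub hr i 0
  rw [Nat.cast_zero, sub_zero] at this
  rw [this, Nat.modEq_zero_iff_dvd]
  exact Nat.not_dvd_of_pos_of_lt h0 hi

theorem rowShift_one (r : ℕ) : RowShift m r 1 := by
  intro p hp j h1 hj
  refine laverOp_natCast_of_dvd hp (fun i h0 hi => ?_) h1 hj
  rcases le_total r m with hr | hr
  · refine two_pow_dvd_laverOp_self ?_
    rw [dvd_add_right hp]
    exact natCast_not_dvd hr h0 hi
  · simp [two_pow_eq_zero hr, laverOp_zero]

/-- For `j < 2 ^ r` the shift gives `p ∘ j ≡ p + j`, so the row of `p + j` is a composite of rows.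
-/
theorem RowShift.add_laverOp {r K : ℕ} (h : RowShift m r K) {p : ZMod (2 ^ m)} (hp : 2 ^ r ∣ p)
    {j : ℕ} (hj : j < 2 ^ r) (s : ZMod (2 ^ m)) :
    PowCong (r + K) ((p + (j : ZMod (2 ^ m))) ⋆ s) (p ⋆ ((j : ZMod (2 ^ m)) ⋆ s)) := by
  rw [← comp_laverOp]
  refine PowCong.laverOp_left ?_ s
  have := (h p hp (j + 1) (by omega) hj).symm.add_right (-1)
  simpa [← add_assoc, sub_eq_add_neg] using this

theorem cast_two_pow_sub_one (r : ℕ) : ((2 ^ r - 1 : ℕ) : ZMod (2 ^ m)) = 2 ^ r - 1 := by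
  rw [Nat.cast_sub Nat.one_le_two_pow]
  simp

theorem RowShift.pred_laverOp {r K : ℕ} (h : RowShift m r K) (s : ZMod (2 ^ m)) :
    PowCong (r + K) ((2 ^ r - 1) ⋆ s) (2 ^ r * s) := by
  induction s using zmod_induction with
  | zero => simpa [laverOp_zero] using PowCong.refl _
  | add_one s ih =>
    rw [laverOp_add_one, sub_add_cancel]
    refine (ih.laverOp_left _).trans ?_
    have := h (2 ^ r * s) (dvd_mul_right _ _) (2 ^ r) Nat.one_le_two_pow le_rfl
    rw [mul_add, mul_one]
    simpa using this

/-- Replace `2^(ρ+w)` by `(2^ρ - 1) ⋆ 2^w`. The two rows then compose to that of `2^ρ (2^w - 1) +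
2^ρ - 1 = 2^(ρ+w) - 1`, which acts on `2^w` as multiplication by `2^(ρ+w)`. -/
theorem RowShift.exact {ρ w : ℕ} (h : RowShift m ρ (2 * w + 1)) (h' : RowShift m (ρ + w) (w + 1)) :
    PowCong (ρ + 2 * w + 1) (((2 : ZMod (2 ^ m)) ^ ρ * (2 ^ w - 1)) ⋆ 2 ^ (ρ + w))
      (2 ^ (ρ + 2 * w)) := by
  have h1 := ((h.pred_laverOp (2 ^ w)).laverOp_right (2 ^ ρ * (2 ^ w - 1))).symm
  have h2 := h.add_laverOp (dvd_mul_right (2 ^ ρ) (2 ^ w - 1)) (j := 2 ^ ρ - 1)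
    (Nat.sub_lt (by positivity) one_pos) (2 ^ w)
  rw [cast_two_pow_sub_one] at h2
  have h3 := h'.pred_laverOp (2 ^ w)
  have e1 : (2 : ZMod (2 ^ m)) ^ ρ * (2 ^ w - 1) + (2 ^ ρ - 1) = 2 ^ (ρ + w) - 1 := by ring
  rw [e1] at h2
  rw [← pow_add] at h1 h3
  rw [show ρ + w + (w + 1) = ρ + 2 * w + 1 by ring, show ρ + w + w = ρ + 2 * w by ring] at h3
  exact h1.trans (h2.symm.trans h3)

theorem exists_add_natCast (r : ℕ) (p : ZMod (2 ^ m)) :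
    ∃ p₁ : ZMod (2 ^ m), ∃ i : ℕ, 2 ^ r ∣ p₁ ∧ i < 2 ^ r ∧ p = p₁ + i := by
  refine ⟨p - (p.val % 2 ^ r : ℕ), p.val % 2 ^ r, ?_, Nat.mod_lt _ (by positivity), by ring⟩
  have h : (p.val : ZMod (2 ^ m)) = p := by rw [ZMod.natCast_val, ZMod.cast_id]
  conv_rhs => rw [← h]
  nth_rewrite 1 [← Nat.div_add_mod p.val (2 ^ r)]
  push_cast
  rw [add_sub_assoc]
  simp

theorem val_mod_lt_of_dvd {r c : ℕ} {p : ZMod (2 ^ m)} (hp : 2 ^ c ∣ p) {i : ℕ}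
    (hi : i < 2 ^ r)
    (hrc : r ≤ c) (hrm : r ≤ m) : (p + (i : ZMod (2 ^ m))).val % 2 ^ c < 2 ^ r := by
  rcases le_total c m with hc | hc
  · have h1 : PowCong c (p + (i : ZMod (2 ^ m))) i := by simpa [PowCong] using hp
    have h2 : ((p + (i : ZMod (2 ^ m))).val : ZMod (2 ^ m)) = p + i := by rw [ZMod.natCast_val, ZMod.cast_id]
    rw [← h2, PowCong, two_pow_dvd_natCast_sub hc] at h1
    have h3 : 2 ^ r ≤ 2 ^ c := Nat.pow_le_pow_right (by norm_num) hrc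
    rw [h1, Nat.mod_eq_of_lt (by omega)]
    exact hi
  · rw [two_pow_eq_zero hc, zero_dvd_iff] at hp
    have h3 : 2 ^ r ≤ 2 ^ m := Nat.pow_le_pow_right (by norm_num) hrm
    rw [hp, zero_add, ZMod.val_natCast, Nat.mod_eq_of_lt (show i < 2 ^ m by omega)]
    exact (Nat.mod_le _ _).trans_lt hi

theorem lt_val_mod_of_not_dvd {r c : ℕ} {p : ZMod (2 ^ m)} (hp : 2 ^ r ∣ p) (hpc : ¬ 2 ^ c ∣ p)
    (hrc : r ≤ c) {i : ℕ} (hi : i < 2 ^ r) : 2 ^ r ≤ (p + (i : ZMod (2 ^ m))).val % 2 ^ c := by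
  by_contra! h
  apply hpc
  set k := (p + (i : ZMod (2 ^ m))).val % 2 ^ c with hk
  have h2 : ((p + (i : ZMod (2 ^ m))).val : ZMod (2 ^ m)) = p + i := by rw [ZMod.natCast_val, ZMod.cast_id]
  have h3 : (2 : ZMod (2 ^ m)) ^ c ∣ p + i - k := by
    rw [← h2, hk]
    nth_rewrite 1 [← Nat.div_add_mod (p + (i : ZMod (2 ^ m))).val (2 ^ c)]
    push_cast
    rw [add_sub_assoc]
    simp
  have h4 : (2 : ZMod (2 ^ m)) ^ r ∣ (i : ZMod (2 ^ m)) - k := by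
    have h5 := (pow_dvd_pow 2 hrc).trans h3
    rwa [add_sub_assoc, dvd_add_right hp] at h5
  rcases le_total r m with hrm | hrm
  · rw [two_pow_dvd_natCast_sub hrm] at h4
    rw [Nat.ModEq.eq_of_lt_of_lt h4 hi h] at h3
    simpa using h3
  · rw [two_pow_eq_zero hrm, zero_dvd_iff] at hp
    rw [hp]
    exact dvd_zero _

/-- An element which maps `y`, exactly divisible by `2 ^ R`, to a multiple of `2 ^ C` maps
`2 ^ R` to a multiple of `2 ^ C`. -/
theorem two_pow_dvd_laverOp_of_powCong {R C : ℕ} {p y : ZMod (2 ^ m)}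
    (hy : PowCong (R + 1) y (2 ^ R)) (h : 2 ^ C ∣ p ⋆ y) : 2 ^ C ∣ p ⋆ 2 ^ R :=
  dvd_laverOp_of_dvd h hy.dvd_two_pow

/-! ### Doubling the range of the shift. -/

/-- Descending induction on `p` modulo `2^(r+D)`. With `p = p₁ + i`, the cases depend on whether the
period of `i` modulo `2^r` divides `2^ρ`. -/
theorem dvd_laverOp_of_middle {r D K ρ : ℕ} (hr : r = ρ + D)
    (hKD : K ≤ 2 * D) (hD : 0 < D) (hT : RowShift m r D) (hP : SplitsPower m D ρ)
    (hG : ∀ q : ZMod (2 ^ m), ¬ 2 ^ (r + D) ∣ q → 2 ^ (r + K) ∣ q ⋆ 2 ^ (r + D))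
    (p : ZMod (2 ^ m)) (hp : ¬ 2 ^ r ∣ p) (hpv : 2 ^ r ≤ p.val % 2 ^ (r + D)) :
    2 ^ (r + K) ∣ p ⋆ 2 ^ r := by
  obtain ⟨k, hk⟩ : ∃ k, 2 ^ (r + D) - p.val % 2 ^ (r + D) ≤ k := ⟨_, le_rfl⟩
  induction k generalizing p with
  | zero =>
    have : p.val % 2 ^ (r + D) < 2 ^ (r + D) := Nat.mod_lt _ (by positivity)
    omega
  | succ k ih =>
    rcases lt_or_ge m r with hrm | hrm
    · rw [two_pow_eq_zero hrm.le, laverOp_zero]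
      exact dvd_zero _
    obtain ⟨p₁, i, hp₁, hi, rfl⟩ := exists_add_natCast r p
    have hp₁' : ¬ (2 : ZMod (2 ^ m)) ^ (r + D) ∣ p₁ := by
      intro h
      have := val_mod_lt_of_dvd h hi (by omega) hrm
      omega
    have hi0 : ¬ (2 : ZMod (2 ^ m)) ^ r ∣ i := by rwa [dvd_add_right hp₁] at hp
    by_cases hA : (2 : ZMod (2 ^ m)) ^ r ∣ (i : ZMod (2 ^ m)) ⋆ 2 ^ ρ
    · by_cases hA' : (2 : ZMod (2 ^ m)) ^ (r + D) ∣ (p₁ + i) ⋆ 2 ^ ρ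
      · have := two_pow_dvd_laverOp_add hA' D
        rw [← hr] at this
        exact (pow_dvd_pow 2 (by omega)).trans this
      -- Split modulo `2^(r+D)`. The period bound comes from `p ⋆ s ≡ p₁ ⋆ (i ⋆ s)`, and `hG`
      -- handles the row of `p ⋆ (2^ρ b)`.
      · have h1 : (2 : ZMod (2 ^ m)) ^ (r + D) ∣ (p₁ + i) ⋆ 2 ^ (ρ + D - 1) := by
          rw [(hT.add_laverOp hp₁ hi _).dvd_iff]
          refine dvd_laverOp_of_dvd (two_pow_dvd_laverOp_pred hp₁') ?_
          have := two_pow_dvd_laverOp_add hA (D - 1)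
          rwa [← Nat.add_sub_assoc hD, ← Nat.add_sub_assoc hD] at this
        obtain ⟨b, x, hb, hx, hn⟩ := hP _ _ hA' h1
        rw [← hr] at hb
        refine two_pow_dvd_laverOp_of_powCong hb ?_
        rw [laverOp_laverOp]
        exact dvd_laverOp_of_dvd (hG _ hn) hx
    · have h0 : PowCong r (p₁ + (i : ZMod (2 ^ m))) i := by simpa [PowCong] using hp₁
      rw [← (h0.laverOp_left _).dvd_iff] at hA
      have h1 := two_pow_dvd_laverOp_pred hp
      nth_rewrite 2 [hr] at h1
      obtain ⟨b, x, hb, hx, hn⟩ := hP _ _ hA h1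
      rw [← hr] at hb
      refine two_pow_dvd_laverOp_of_powCong hb ?_
      rw [laverOp_laverOp]
      have hle : (2 : ZMod (2 ^ m)) ^ r ∣ 2 ^ (r + D) := pow_dvd_pow 2 (by omega)
      -- The splitting is modulo `2^r`, but the comparison is modulo `2^(r+D)`: this keeps the new
      -- element at least `2^r`, as the induction requires.
      have hlt := val_mod_lt_laverOp (c := r + D) (fun h => hp (hle.trans h))
        (fun h => hn (hle.trans h))
      exact dvd_laverOp_of_dvd (ih _ hn (by omega) (by omega)) hx

/-- If `2^(r+D) ∣ p`, the longer segment at `r + D` suffices. Otherwise every `p + i` with `0 < i <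
2^r` is at least `2^r` modulo `2^(r+D)`, so `h` bounds its period. -/
theorem rowShift_of_middle {r D K : ℕ} (hDK : K ≤ 2 * D) (hT : RowShift m (r + D) D)
    (h : ∀ p : ZMod (2 ^ m), ¬ 2 ^ r ∣ p → 2 ^ r ≤ p.val % 2 ^ (r + D) →
      2 ^ (r + K) ∣ p ⋆ 2 ^ r) : RowShift m r K := by
  intro p hp j h1 hj
  by_cases hpD : 2 ^ (r + D) ∣ p
  · exact (hT p hpD j h1 (hj.trans (Nat.pow_le_pow_right (by norm_num) (by omega)))).mono
      (by omega)
  · refine laverOp_natCast_of_dvd hp (fun i h0 hi => ?_) h1 hj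
    rcases le_total r m with hr | hr
    · refine h _ ?_ (lt_val_mod_of_not_dvd hp hpD (by omega) hi)
      rw [dvd_add_right hp]
      exact natCast_not_dvd hr h0 hi
    · simp [two_pow_eq_zero hr, laverOp_zero]

/-- If `2^(r+D) ∣ q ⋆ 2^r`, replace `2^(r+D)` by `(2^r - 1) ⋆ 2^D`: composition gives the row of `q
⋆ 2^r - 1`, which factors through that of `2^(r+D) - 1`, and this one sends `2^D` to 0 modulo
`2^(r+2D)`. Otherwise split and use descending induction on `q` modulo `2^(r+D)`. -/
theorem dvd_laverOp_two_pow_add {r D : ℕ} (hT : RowShift m r (D + 1))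
    (hT' : RowShift m (r + D) D) (hP : SplitsPower m D r) (q : ZMod (2 ^ m))
    (hq : ¬ 2 ^ (r + D) ∣ q) : 2 ^ (r + D + D) ∣ q ⋆ 2 ^ (r + D) := by
  obtain ⟨k, hk⟩ : ∃ k, 2 ^ (r + D) - q.val % 2 ^ (r + D) ≤ k := ⟨_, le_rfl⟩
  induction k generalizing q with
  | zero =>
    have : q.val % 2 ^ (r + D) < 2 ^ (r + D) := Nat.mod_lt _ (by positivity)
    omega
  | succ k ih =>
    by_cases h : (2 : ZMod (2 ^ m)) ^ (r + D) ∣ q ⋆ 2 ^ r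
    · have h1 := hT.pred_laverOp (2 ^ D)
      rw [← pow_add, ← add_assoc] at h1
      refine two_pow_dvd_laverOp_of_powCong h1 ?_
      rw [← comp_laverOp, sub_add_cancel]
      have h2 := hT'.add_laverOp (p := q ⋆ 2 ^ r - 2 ^ (r + D)) (dvd_sub h dvd_rfl)
        (j := 2 ^ (r + D) - 1) (Nat.sub_lt (by positivity) one_pos) (2 ^ D)
      rw [cast_two_pow_sub_one, sub_add_sub_cancel] at h2
      rw [h2.dvd_iff]
      refine dvd_laverOp _ ?_
      rw [(hT'.pred_laverOp (2 ^ D)).dvd_iff, ← pow_add]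
    · obtain ⟨b, x, hb, hx, hn⟩ := hP _ _ h (two_pow_dvd_laverOp_pred hq)
      refine two_pow_dvd_laverOp_of_powCong hb ?_
      rw [laverOp_laverOp]
      have hlt := val_mod_lt_laverOp hq hn
      exact dvd_laverOp_of_dvd (ih _ hn (by omega)) hx

theorem rowShift_two_mul {D : ℕ} (hD : 0 < D) (hT : ∀ ρ, D ∣ ρ → RowShift m ρ D)
    (hP : ∀ ρ, D ∣ ρ → RowShift m ρ (D + 1) → SplitsPower m D ρ) (s : ℕ) :
    RowShift m (D * s) (2 * D) := by
  have step : ∀ r, D ∣ r → (∀ K, K ≤ 2 * D →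
      (∀ q : ZMod (2 ^ m), ¬ 2 ^ (r + D) ∣ q → 2 ^ (r + K) ∣ q ⋆ 2 ^ (r + D)) →
      ∀ p : ZMod (2 ^ m), ¬ 2 ^ r ∣ p → 2 ^ r ≤ p.val % 2 ^ (r + D) →
      2 ^ (r + K) ∣ p ⋆ 2 ^ r) → RowShift m r (2 * D) := by
    intro r hr h
    have hrD : D ∣ r + D := (Nat.dvd_add_self_right).2 hr
    -- A bootstrap: the general period bound gives range `D + 1`. This makes splitting available at
    -- `r`, which yields the stronger period bound needed for range `2 * D`.
    have h1 : RowShift m r (D + 1) := rowShift_of_middle (by omega) (hT _ hrD)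
      (h _ (by omega) fun q hq => by
        rw [← add_assoc]
        exact two_pow_dvd_laverOp_self hq)
    refine rowShift_of_middle le_rfl (hT _ hrD) (h _ le_rfl fun q hq => ?_)
    have := dvd_laverOp_two_pow_add h1 (hT _ hrD) (hP r hr h1) q hq
    rwa [add_assoc, ← two_mul] at this
  induction s with
  | zero => exact step _ (dvd_mul_right _ _) fun K _ _ p hp => absurd (by simp) hp
  | succ s ih =>
    -- The splitting used at `D * (s + 1)` is the one at `D * s`, available from the induction
    -- hypothesis.
    refine step _ (dvd_mul_right _ _) fun K hK hG p hp hpv => ?_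
    exact dvd_laverOp_of_middle (mul_add_one D s) hK hD (hT _ (dvd_mul_right _ _))
      (hP _ (dvd_mul_right _ _) (ih.mono (by omega))) hG p hp hpv

/-! ### Induction on `d`, with `D = 2 ^ d`. -/

theorem splitsPower_one (ρ : ℕ) : SplitsPower m 1 ρ := fun _ _ h h' => absurd h' h

/-- The period either divides `2^(ρ+D)`, where `RowShift.exact` gives the splitting, or lies beyond
it, where the splitting at `ρ + D` applies with `b` rescaled by `2^D`. -/
theorem SplitsPower.double {D ρ : ℕ} (hD : 0 < D) (h : SplitsPower m D (ρ + D))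
    (hT : RowShift m ρ (2 * D + 1)) (hT' : RowShift m (ρ + D) (D + 1)) :
    SplitsPower m (2 * D) ρ := by
  intro p C h1 h2
  by_cases h3 : 2 ^ C ∣ p ⋆ 2 ^ (ρ + D)
  · refine ⟨2 ^ D - 1, D, RowShift.exact hT hT', h3, fun h4 => h1 ?_⟩
    refine dvd_laverOp_of_dvd h4 ?_
    -- For `D > 0` the element `2^D - 1` is a unit, so `2^ρ (2^D - 1)` divides `2^ρ`.
    obtain ⟨D, rfl⟩ := Nat.exists_eq_add_of_le' hD
    have h5 : (2 : ZMod (2 ^ m)) ^ (D + 1) - 1 = -(1 + 2 * (-2 ^ D)) := by ring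
    rw [h5, (isUnit_one_add_two_mul _).neg.mul_right_dvd]
  · rw [two_mul, ← add_assoc] at h2
    obtain ⟨b, x, hb, hx, hn⟩ := h p C h3 h2
    refine ⟨2 ^ D * b, D + x, ?_, ?_, ?_⟩
    · rwa [← mul_assoc, ← pow_add, two_mul, ← add_assoc, ← add_assoc]
    · rwa [← add_assoc]
    · rwa [← mul_assoc, ← pow_add]

theorem rowShift_and_splitsPower (d : ℕ) : (∀ ρ, 2 ^ d ∣ ρ → RowShift m ρ (2 ^ d)) ∧
    ∀ ρ, 2 ^ d ∣ ρ → RowShift m ρ (2 ^ d + 1) → SplitsPower m (2 ^ d) ρ := by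
  induction d with
  | zero => exact ⟨fun ρ _ => rowShift_one ρ, fun ρ _ _ => splitsPower_one ρ⟩
  | succ d ih =>
    have hD : 0 < 2 ^ d := by positivity
    have h : ∀ ρ, 2 ^ d ∣ ρ → RowShift m ρ (2 * 2 ^ d) := by
      rintro _ ⟨s, rfl⟩
      exact rowShift_two_mul hD ih.1 ih.2 s
    rw [pow_succ']
    have hd : ∀ {ρ}, 2 * 2 ^ d ∣ ρ → 2 ^ d ∣ ρ := fun h => (dvd_mul_left _ _).trans h
    refine ⟨fun ρ hρ => h ρ (hd hρ), fun ρ hρ hT => ?_⟩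
    have h1 := (h (ρ + 2 ^ d) (Nat.dvd_add_self_right.2 (hd hρ))).mono
      (show 2 ^ d + 1 ≤ 2 * 2 ^ d by omega)
    exact (ih.2 _ (Nat.dvd_add_self_right.2 (hd hρ)) h1).double hD hT h1

end RowShift

/-! ### Multiplication by `2 ^ r` as an endomorphism. -/

section Multiplication
variable {m : ℕ}

theorem PowCong.eq {c : ℕ} (h : m ≤ c) {x y : ZMod (2 ^ m)} (hxy : PowCong c x y) : x = y := by
  rwa [PowCong, two_pow_eq_zero h, zero_dvd_iff, sub_eq_zero] at hxy

/-- Multiplication by `2 ^ r` is an endomorphism of the table of order `2 ^ m`. -/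
theorem RowShift.mul_laverOp_mul {r K : ℕ} (h : RowShift m r K) (hm : m ≤ r + K)
    (a b : ZMod (2 ^ m)) : (2 ^ r * a) ⋆ (2 ^ r * b) = 2 ^ r * (a ⋆ b) := by
  have h1 : ∀ a : ZMod (2 ^ m), (2 ^ r * a) ⋆ 2 ^ r = 2 ^ r * (a + 1) := by
    intro a
    have := (h (2 ^ r * a) (dvd_mul_right _ _) (2 ^ r) Nat.one_le_two_pow le_rfl).eq hm
    rw [Nat.cast_pow, Nat.cast_ofNat] at this
    rw [this, mul_add, mul_one]
  obtain ⟨k, hk⟩ : ∃ k, 2 ^ m - a.val ≤ k := ⟨_, le_rfl⟩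
  induction k generalizing a b with
  | zero => have := ZMod.val_lt a; omega
  | succ k iha =>
    by_cases ha : a = 0
    · simp [ha, zero_laverOp]
    induction b using zmod_induction with
    | zero => simp [laverOp_zero]
    | add_one b ihb =>
      -- Writing `2^r (b + 1)` as `(2^r b) ⋆ 2^r` lets distributivity reduce to the row of `a ⋆ b`,
      -- which is 0 or larger than `a`.
      rw [← h1 b, laverOp_laverOp, ihb, h1, laverOp_add_one]
      by_cases hab : a ⋆ b = 0
      · simp [hab, zero_laverOp]
      · have := val_lt_laverOp ha hab
        exact iha _ _ (by omega)

theorem RowShift.mul_sub_one_laverOp {r K : ℕ} (h : RowShift m r K) (hm : m ≤ r + K)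
    (a s : ZMod (2 ^ m)) : (2 ^ r * a - 1) ⋆ s = 2 ^ r * ((a - 1) ⋆ s) := by
  induction s using zmod_induction with
  | zero => simp [laverOp_zero]
  | add_one s ih =>
    rw [laverOp_add_one, ih, sub_add_cancel, h.mul_laverOp_mul hm, laverOp_add_one, sub_add_cancel]

end Multiplication

/-! ### Return to the backwards operation. -/

/-- Valid for every `c`, even when `2^c ≤ max p q`, because reduction modulo `2^c` is a
homomorphism. -/
theorem natCast_backStar (c p q : ℕ) :
    (backStar p q : ZMod (2 ^ c)) = -((-(p : ZMod (2 ^ c))) ⋆ (-(q : ZMod (2 ^ c)))) := by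
  obtain ⟨m, hm⟩ : ∃ m, m = max c (Nat.size (max p q)) := ⟨_, rfl⟩
  have hc : c ≤ m := hm ▸ le_max_left _ _
  have hpq : max p q < 2 ^ m := Nat.size_le.1 (hm ▸ le_max_right _ _)
  obtain ⟨hp, hq⟩ := max_lt_iff.1 hpq
  have key : ∀ {x : ℕ}, x < 2 ^ m → 2 ^ m - x ∈ Set.Icc 1 (2 ^ m) ∧
      2 ^ m - x ≡ 2 ^ c - (- -(x : ZMod (2 ^ c))).val [MOD 2 ^ c] := by
    intro x hx
    refine ⟨⟨by omega, by omega⟩, ?_⟩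
    rw [← ZMod.natCast_eq_natCast_iff, natCast_sub_neg_val, Nat.cast_sub hx.le]
    push_cast
    have : (2 : ZMod (2 ^ c)) ^ m = 0 := two_pow_eq_zero hc
    rw [this, zero_sub]
  have h := laverStar_modEq hc (key hp).1 (key hq).1 (neg_val_sub_mem _) (neg_val_sub_mem _)
    (key hp).2 (key hq).2
  rw [← ZMod.natCast_eq_natCast_iff] at h
  rw [backStar_eq hp hq, Nat.cast_sub (laverStar_mem (key hp).1 (key hq).1).2, h, laverOp]
  push_cast
  rw [two_pow_eq_zero hc, zero_sub]

theorem backStar_lt {p : ℕ} (hp : 1 ≤ p) (q : ℕ) : backStar p q < p := by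
  have hm : max p q < 2 ^ Nat.size (max p q) := Nat.lt_size_self _
  obtain ⟨h1, h2⟩ := max_lt_iff.1 hm
  unfold backStar
  generalize 2 ^ Nat.size (max p q) = N at h1 h2
  have := laverStar_gt N _ (N - p) (N - q) le_rfl (by omega) (by omega)
  omega

theorem eq_of_natCast_eq {c a b : ℕ} (ha : a < 2 ^ c) (hb : b < 2 ^ c)
    (h : (a : ZMod (2 ^ c)) = b) : a = b :=
  Nat.ModEq.eq_of_lt_of_lt ((ZMod.natCast_eq_natCast_iff _ _ _).1 h) ha hb

/-- The values in the row of `p` are below `p ≤ 2^c`, hence determined modulo `2^c`. -/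
theorem backStar_add_two_pow {c p : ℕ} (hp : 1 ≤ p) (hpc : p ≤ 2 ^ c) (q : ℕ) :
    backStar p (q + 2 ^ c) = backStar p q := by
  refine eq_of_natCast_eq ((backStar_lt hp _).trans_le hpc) ((backStar_lt hp _).trans_le hpc) ?_
  rw [natCast_backStar, natCast_backStar, Nat.cast_add, natCast_two_pow_self, add_zero]

theorem exists_isRowPeriod {p : ℕ} (hp : 1 ≤ p) : ∃ t, IsRowPeriod p t := by
  classical
  have h : ∃ s : ℕ, 0 < s ∧ ∀ q : ℕ, backStar p (q + s) = backStar p q :=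
    ⟨2 ^ p, by positivity, backStar_add_two_pow hp Nat.lt_two_pow_self.le⟩
  exact ⟨Nat.find h, Nat.find_spec h, fun s hs => Nat.find_min' h hs⟩

theorem two_pow_two_pow_mul_backStar (n r : ℕ) (hr : r < 2 ^ (2 ^ n)) (q : ℕ) :
    2 ^ (2 ^ n) * backStar (1 + r) q = backStar (1 + r * 2 ^ (2 ^ n)) q := by
  have h := (rowShift_and_splitsPower (m := 2 ^ n + 2 ^ n) n).1 (2 ^ n) dvd_rfl
  have hM : 0 < 2 ^ (2 ^ n) := by positivity
  have h1 := backStar_lt (p := 1 + r) (by omega) q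
  have h2 := backStar_lt (p := 1 + r * 2 ^ (2 ^ n)) (by omega) q
  -- Both sides are below `2^(2^n + 2^n)`, which is also the modulus for which `h` is an exact
  -- identity.
  refine eq_of_natCast_eq (c := 2 ^ n + 2 ^ n) ?_ ?_ ?_
  · rw [pow_add]
    exact Nat.mul_lt_mul_of_pos_left (by omega) hM
  · rw [pow_add]
    have : (r + 1) * 2 ^ (2 ^ n) ≤ 2 ^ (2 ^ n) * 2 ^ (2 ^ n) := Nat.mul_le_mul_right _ hr
    rw [add_mul, one_mul] at this
    omega
  · have h3 := h.mul_sub_one_laverOp le_rfl (-(r : ZMod _)) (-(q : ZMod _))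
    rw [Nat.cast_mul, natCast_backStar, natCast_backStar]
    push_cast
    rw [mul_neg, neg_add, neg_add, neg_add_eq_sub, neg_add_eq_sub, ← h3]
    congr 2
    ring

theorem mainTheorem10 (n r : ℕ) (hr : r < 2 ^ (2 ^ n)) :
    (∀ q : ℕ, 2 ^ (2 ^ n) * backStar (1 + r) q = backStar (1 + r * 2 ^ (2 ^ n)) q) ∧
    (∃ t : ℕ, IsRowPeriod (1 + r) t ∧ IsRowPeriod (1 + r * 2 ^ (2 ^ n)) t) := by
  have h := two_pow_two_pow_mul_backStar n r hr
  refine ⟨h, ?_⟩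
  obtain ⟨t, ht⟩ := exists_isRowPeriod (p := 1 + r) (by omega)
  refine ⟨t, ht, ?_⟩
  have hM : 0 < 2 ^ (2 ^ n) := by positivity
  unfold IsRowPeriod at ht ⊢
  simpa only [← h, Nat.mul_right_inj hM.ne'] using ht
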